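/- Let $\xi$ be a nonnegative random variable whose distribution is nondegenerate (not concentrated at a single point), let $\xi_1,\xi_2,\ldots$ be independent copies of $\xi$, and put $S_n:=\xi_1+\ldots+\xi_n$ for $n\ge 1$. Let $\hat S_1,\hat S_2,\ldots$ be independent random variables such that, for each $n\ge 1$, $\hat S_n$ has the same distribution as $S_n$. For $t\ge 0$ put $\hat N(t):=\sum_{n\ge 1}\mathbf 1_{\{\hat S_n\le t\}}$ and $U(t):=\mathbb E[\hat N(t)]$. Then, for every $t\ge 0$, $\hat N(t)$ is almost surely finite and has a finite second moment, and $$\lim_{t\to\infty}\operatorname{Var}[\hat N(t)]=\infty\qquad\text{and}\qquad \lim_{t\to\infty}\frac{\mathbb P\{\hat N(t)=\lfloor U(t)\rfloor\}}{(2\pi\operatorname{Var}[\hat N(t)])^{-1/2}}=1 .$$ -/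

import Mathlib

open MeasureTheory ProbabilityTheory Filter Topology
open scoped ENNReal

/-- The partial sum `S_{n+1} = ξ_1 + ⋯ + ξ_{n+1}`, where the step `ξ_{k+1}` is stored as `ξ k`.
Thus `randomWalk ξ n` is the `(n+1)`-st term of the sequence `(S_n)_{n ≥ 1}`. -/
def randomWalk {Ω : Type*} (ξ : ℕ → Ω → ℝ) (n : ℕ) (ω : Ω) : ℝ :=
  ∑ k ∈ Finset.range (n + 1), ξ k ω

/-- `ξs` is a sequence of independent copies of the random variable `ξ`. -/
structure IsIndepCopies {Ω₀ Ω : Type*} [MeasurableSpace Ω₀] [MeasurableSpace Ω]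
    (ξ : Ω₀ → ℝ) (P₀ : Measure Ω₀) (ξs : ℕ → Ω → ℝ) (P : Measure Ω) : Prop where
  indep : iIndepFun ξs P
  law : ∀ k, IdentDistrib (ξs k) ξ P P₀

/-- `Shat` is a decoupled version of the sequence `S`: its terms are independent, and each of
them has the same distribution as the corresponding term of `S`. -/
structure IsDecoupled {Ω Ω' : Type*} [MeasurableSpace Ω] [MeasurableSpace Ω']
    (S : ℕ → Ω → ℝ) (P : Measure Ω) (Shat : ℕ → Ω' → ℝ) (P' : Measure Ω') : Prop where
  indep : iIndepFun Shat P'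
  law : ∀ n, IdentDistrib (Shat n) (S n) P' P

/-- The number of terms of the sequence `Shat` that are at most `t`, as a sum of indicators with
values in `[0, ∞]`. -/
noncomputable def countingProcess {Ω' : Type*} (Shat : ℕ → Ω' → ℝ) (t : ℝ) (ω : Ω') : ℝ≥0∞ :=
  ∑' n, Set.indicator {ω' | Shat n ω' ≤ t} (fun _ => (1 : ℝ≥0∞)) ω

/-- The counting process as a real random variable (it is used where the count is almost surely
finite). -/
noncomputable def realCount {Ω' : Type*} (Shat : ℕ → Ω' → ℝ) (t : ℝ) (ω : Ω') : ℝ :=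
  (countingProcess Shat t ω).toReal

/-! ### Estimates for one indicator's characteristic function, and for products. -/

section CharacteristicFunctionBounds

open Complex

/-! For fixed `t` the count is a sum of independent indicators with success probabilities `q n =
P(S_{n+1} ≤ t)`, so its mean is `U = ∑ q n` and its variance is `V = ∑ q n (1 - q n)`. Two facts
suffice: such sums satisfy a local limit theorem as soon as `V → ∞`, and here `V → ∞`.

Local limit: the characteristic function of each indicator has a Gaussian bound on `[-π, π]` and,
after centering, a Gaussian approximation near `0`, with exponent and error both proportional to `q
n (1 - q n)`. Multiplying over `n` gives the same estimates with `V`. Fourier inversion, the scaling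
`θ = s / √V` and dominated convergence then give `√(2πV) P(N = k) → 1` whenever `|U - k| ≤ 1`
(`tendsto_sqrt_mul_measureReal_singleton`).

Divergence of `V`: for fixed `t`, `q` decreases to `0` in `n`, and it starts near `1` when `t` is
large. If its jumps are at most `ε`, then `∑ q (1 - q)` times `ε` dominates, up to an error `ε`, a
Riemann integral of `x (1 - x)`, so `V` has order at least `1 / ε`
(`one_div_le_mul_tsum_mul_one_sub`). The jumps become uniformly small as `t → ∞` because a
nondegenerate walk spreads out: the mass that `S_n` gives to an interval of fixed length tends to
`0` uniformly in its position (`eventually_forall_measureReal_randomWalk_le_sub_le`). No moment of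
`ξ` is needed. -/

theorem norm_bernoulli_charFun_le {p θ : ℝ} (hp0 : 0 ≤ p) (hp1 : p ≤ 1) (hθ : |θ| ≤ Real.pi) :
    ‖(1 - p + p * cexp (θ * I) : ℂ)‖ ≤ Real.exp (-(2 / Real.pi ^ 2 * θ ^ 2 * (p * (1 - p)))) := by
  have hcos := Real.cos_le_one_sub_mul_cos_sq hθ
  have hpq : 0 ≤ p * (1 - p) := mul_nonneg hp0 (by linarith)
  -- The squared modulus is explicit; the bound then follows from `cos θ ≤ 1 - 2 θ² / π²` on `[-π,
  -- π]` and `1 + x ≤ exp x`.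
  have hsq : ‖(1 - p + p * cexp (θ * I) : ℂ)‖ ^ 2 = 1 - 2 * (p * (1 - p)) * (1 - Real.cos θ) := by
    rw [← Complex.normSq_eq_norm_sq, Complex.normSq_apply]
    have hre : (1 - p + p * cexp (θ * I) : ℂ).re = 1 - p + p * Real.cos θ := by
      simp [Complex.exp_ofReal_mul_I_re]
    have him : (1 - p + p * cexp (θ * I) : ℂ).im = p * Real.sin θ := by
      simp [Complex.exp_ofReal_mul_I_im]
    rw [hre, him]
    linear_combination p ^ 2 * Real.sin_sq_add_cos_sq θ
  refine le_of_sq_le_sq ?_ (Real.exp_pos _).le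
  rw [hsq, ← Real.exp_nat_mul]
  have h := Real.add_one_le_exp (((2 : ℕ) : ℝ) * -(2 / Real.pi ^ 2 * θ ^ 2 * (p * (1 - p))))
  refine le_trans ?_ h
  push_cast
  nlinarith [mul_le_mul_of_nonneg_left hcos hpq]

/-- The left factor is `(1 - p) e^a + p e^b` with `(1 - p) a + p b = 0` and `(1 - p) a² / 2 + p b² /
2 = c`, so the second-order Taylor polynomials cancel against `1 + c` and only remainders survive.
Keeping the factor `p (1 - p)` in the error is what makes the errors sum to a multiple of the
variance. -/
theorem norm_centered_bernoulli_charFun_sub_le {p θ : ℝ} (hp0 : 0 ≤ p) (hp1 : p ≤ 1)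
    (hθ : |θ| ≤ 1) :
    ‖cexp (-(θ * p * I)) * (1 - p + p * cexp (θ * I)) - cexp (-(θ ^ 2 * (p * (1 - p)) / 2))‖
      ≤ |θ| ^ 3 * (p * (1 - p)) := by
  have hq0 : 0 ≤ 1 - p := by linarith
  have hpq : 0 ≤ p * (1 - p) := mul_nonneg hp0 hq0
  have hpq1 : p * (1 - p) ≤ 1 := by nlinarith
  have hθ0 := abs_nonneg θ
  have hθ2 : |θ| ^ 2 ≤ 1 := pow_le_one₀ hθ0 hθ
  set a : ℂ := -(θ * p * I) with ha
  set b : ℂ := θ * (1 - p) * I with hb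
  set c : ℂ := -(θ ^ 2 * (p * (1 - p)) / 2) with hc
  have hna : ‖a‖ = |θ| * p := by
    rw [ha, norm_neg, norm_mul, norm_mul]; simp [abs_of_nonneg hp0]
  have hnb : ‖b‖ = |θ| * (1 - p) := by
    have : b = (θ : ℂ) * ((1 - p : ℝ) : ℂ) * I := by rw [hb]; push_cast; ring
    rw [this, norm_mul, norm_mul, norm_I, Complex.norm_real, Complex.norm_real, Real.norm_eq_abs,
      Real.norm_eq_abs, abs_of_nonneg hq0, mul_one]
  have hnc : ‖c‖ = |θ| ^ 2 * (p * (1 - p)) / 2 := by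
    have : c = ((-(θ ^ 2 * (p * (1 - p)) / 2) : ℝ) : ℂ) := by rw [hc]; push_cast; ring
    rw [this, Complex.norm_real, Real.norm_eq_abs, abs_neg, abs_of_nonneg (by positivity), sq_abs]
  have ha1 : ‖a‖ ≤ 1 := by rw [hna]; nlinarith
  have hb1 : ‖b‖ ≤ 1 := by rw [hnb]; nlinarith
  have hc1 : ‖c‖ ≤ 1 := by rw [hnc]; nlinarith
  have ea := Complex.exp_bound ha1 (n := 3) (by norm_num)
  have eb := Complex.exp_bound hb1 (n := 3) (by norm_num)
  have ec := Complex.exp_bound hc1 (n := 2) (by norm_num)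
  simp only [Finset.sum_range_succ, Finset.sum_range_zero, Nat.factorial] at ea eb ec
  have key : cexp a * (1 - p + p * cexp (θ * I)) - cexp c
      = (1 - p) * (cexp a - (1 + a + a ^ 2 / 2)) + p * (cexp b - (1 + b + b ^ 2 / 2))
        - (cexp c - (1 + c)) := by
    have hab : cexp b = cexp a * cexp (θ * I) := by
      rw [← Complex.exp_add]; congr 1; rw [ha, hb]; ring
    rw [hab, ha, hb, hc]
    linear_combination ((θ : ℂ) ^ 2 * p * (1 - p) / 2) * I_sq
  have ea' : ‖cexp a - (1 + a + a ^ 2 / 2)‖ ≤ ‖a‖ ^ 3 * (2 / 9) := by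
    refine (le_of_eq ?_).trans (ea.trans (le_of_eq ?_))
    · congr 2; norm_num
    · norm_num
  have eb' : ‖cexp b - (1 + b + b ^ 2 / 2)‖ ≤ ‖b‖ ^ 3 * (2 / 9) := by
    refine (le_of_eq ?_).trans (eb.trans (le_of_eq ?_))
    · congr 2; norm_num
    · norm_num
  have ec' : ‖cexp c - (1 + c)‖ ≤ ‖c‖ ^ 2 := by
    refine (le_of_eq ?_).trans (ec.trans ?_)
    · congr 2; norm_num
    · norm_num; nlinarith [sq_nonneg ‖c‖]
  have n1 : ‖(1 - p : ℂ)‖ = 1 - p := by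
    have : (1 - p : ℂ) = ((1 - p : ℝ) : ℂ) := by push_cast; ring
    rw [this, Complex.norm_real, Real.norm_eq_abs, abs_of_nonneg hq0]
  have n2 : ‖(p : ℂ)‖ = p := by rw [Complex.norm_real, Real.norm_eq_abs, abs_of_nonneg hp0]
  rw [key]
  calc _ ≤ (1 - p) * (‖a‖ ^ 3 * (2 / 9)) + p * (‖b‖ ^ 3 * (2 / 9)) + ‖c‖ ^ 2 := by
        refine (norm_sub_le _ _).trans (add_le_add ((norm_add_le _ _).trans (add_le_add ?_ ?_)) ec')
        · rw [norm_mul, n1]; gcongr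
        · rw [norm_mul, n2]; gcongr
    _ = |θ| ^ 3 * (p * (1 - p)) * ((2 / 9) * (p ^ 2 + (1 - p) ^ 2)
          + |θ| * (p * (1 - p)) / 4) := by rw [hna, hnb, hnc]; ring
    _ ≤ |θ| ^ 3 * (p * (1 - p)) * 1 := by
        have : |θ| * (p * (1 - p)) ≤ 1 := mul_le_one₀ hθ hpq hpq1
        gcongr
        nlinarith
    _ = _ := mul_one _

/-- Replace the factors one at a time; all the other factors have norm at most `1`. -/
theorem Finset.norm_prod_sub_prod_le_sum {ι R : Type*} [NormedCommRing R] [NormOneClass R]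
    (s : Finset ι) (f g : ι → R) (hf : ∀ i ∈ s, ‖f i‖ ≤ 1) (hg : ∀ i ∈ s, ‖g i‖ ≤ 1) :
    ‖∏ i ∈ s, f i - ∏ i ∈ s, g i‖ ≤ ∑ i ∈ s, ‖f i - g i‖ := by
  classical
  induction s using Finset.induction_on with
  | empty => simp
  | insert i s hi ih =>
    rw [Finset.prod_insert hi, Finset.prod_insert hi, Finset.sum_insert hi]
    have hf' := hf i (Finset.mem_insert_self _ _)
    have hg' : ‖∏ j ∈ s, g j‖ ≤ 1 := (Finset.norm_prod_le _ _).trans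
      (Finset.prod_le_one (fun _ _ => norm_nonneg _) fun j hj => hg j (Finset.mem_insert_of_mem hj))
    have ih' := ih (fun j hj => hf j (Finset.mem_insert_of_mem hj))
      (fun j hj => hg j (Finset.mem_insert_of_mem hj))
    calc ‖f i * ∏ j ∈ s, f j - g i * ∏ j ∈ s, g j‖
        = ‖(f i - g i) * ∏ j ∈ s, g j + f i * (∏ j ∈ s, f j - ∏ j ∈ s, g j)‖ := by
          congr 1; ring
      _ ≤ ‖f i - g i‖ * ‖∏ j ∈ s, g j‖ + ‖f i‖ * ‖∏ j ∈ s, f j - ∏ j ∈ s, g j‖ :=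
          (norm_add_le _ _).trans (add_le_add (norm_mul_le _ _) (norm_mul_le _ _))
      _ ≤ ‖f i - g i‖ * 1 + 1 * ‖∏ j ∈ s, f j - ∏ j ∈ s, g j‖ := by gcongr
      _ ≤ _ := by linarith

end CharacteristicFunctionBounds

/-! ### Fourier inversion and the analytic local limit theorem. -/

section LocalLimit

open Complex

/-- By Fubini, this is orthogonality of the characters `e^{inθ}` over one period. -/
theorem measureReal_singleton_eq_integral_charFun {μ : Measure ℝ} [IsProbabilityMeasure μ]
    (hμ : ∀ᵐ x ∂μ, ∃ n : ℕ, x = (n : ℝ)) (k : ℕ) :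
    ((2 * Real.pi * μ.real {(k : ℝ)} : ℝ) : ℂ)
      = ∫ θ in (-Real.pi)..Real.pi, cexp (-(θ * k * I)) * charFun μ θ := by
  have : IsFiniteMeasure (volume.restrict (Set.uIoc (-Real.pi) Real.pi)) :=
    ⟨by simp [Set.uIoc]⟩
  have hint : Integrable (Function.uncurry fun (θ : ℝ) (x : ℝ) =>
      cexp (-(θ * k * I)) * cexp (θ * x * I))
      ((volume.restrict (Set.uIoc (-Real.pi) Real.pi)).prod μ) := by
    refine Integrable.of_bound (C := 1) ?_ (Eventually.of_forall fun z => ?_)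
    · exact Continuous.aestronglyMeasurable (by unfold Function.uncurry; fun_prop)
    · have h1 : (-(z.1 * k * I) : ℂ) = ((-(z.1 * k) : ℝ) : ℂ) * I := by push_cast; ring
      have h2 : (z.1 * z.2 * I : ℂ) = ((z.1 * z.2 : ℝ) : ℂ) * I := by push_cast; ring
      simp only [Function.uncurry]
      rw [norm_mul, h1, h2, norm_exp_ofReal_mul_I, norm_exp_ofReal_mul_I, mul_one]
  simp_rw [charFun_apply_real, ← integral_const_mul]
  rw [intervalIntegral_integral_swap hint]
  have hpt : ∀ᵐ x : ℝ ∂μ, (∫ θ in (-Real.pi)..Real.pi, cexp (-(θ * k * I)) * cexp (θ * x * I))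
      = Set.indicator {(k : ℝ)} (fun _ => ((2 * Real.pi : ℝ) : ℂ)) x := by
    filter_upwards [hμ] with x ⟨n, hn⟩
    by_cases hnk : n = k
    · have hxk : x = k := by rw [hn, hnk]
      rw [Set.indicator_of_mem (by simp [hxk]), hxk]
      simp_rw [← Complex.exp_add]
      simp
      ring
    · have hxk : x ≠ k := by rw [hn]; exact_mod_cast hnk
      rw [Set.indicator_of_notMem (by simpa using hxk)]
      have hc : ((n : ℂ) - k) * I ≠ 0 :=
        mul_ne_zero (sub_ne_zero.mpr (by exact_mod_cast hnk)) I_ne_zero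
      have : ∀ θ : ℝ, cexp (-(θ * k * I)) * cexp (θ * x * I) = cexp (((n : ℂ) - k) * I * θ) := by
        intro θ
        rw [← Complex.exp_add, hn]; congr 1; push_cast; ring
      simp_rw [this]
      rw [integral_exp_mul_complex hc]
      have hper : cexp (((n : ℂ) - k) * I * (Real.pi : ℝ))
          = cexp (((n : ℂ) - k) * I * ((-Real.pi : ℝ) : ℂ)) := by
        rw [Complex.exp_eq_exp_iff_exists_int]
        exact ⟨(n : ℤ) - k, by push_cast; ring⟩
      rw [hper, sub_self, zero_div]
  rw [integral_congr_ae hpt, integral_indicator (measurableSet_singleton _), setIntegral_const]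
  simp [mul_comm]

/-- A local limit theorem for laws on `ℕ` whose characteristic functions are dominated by, and
close to, Gaussian ones. -/
theorem tendsto_sqrt_mul_measureReal_singleton {ι : Type*} {l : Filter ι} [l.IsCountablyGenerated]
    {μ : ι → Measure ℝ} [∀ a, IsProbabilityMeasure (μ a)] {U V : ι → ℝ} {k : ι → ℕ}
    (hnat : ∀ᶠ a in l, ∀ᵐ x ∂μ a, ∃ n : ℕ, x = (n : ℝ))
    (hdom : ∀ᶠ a in l, ∀ θ : ℝ, |θ| ≤ Real.pi →
      ‖charFun (μ a) θ‖ ≤ Real.exp (-(2 / Real.pi ^ 2 * θ ^ 2 * V a)))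
    (hclose : ∀ᶠ a in l, ∀ θ : ℝ, |θ| ≤ 1 →
      ‖cexp (-(θ * U a * I)) * charFun (μ a) θ - cexp (-(θ ^ 2 * V a / 2))‖ ≤ |θ| ^ 3 * V a)
    (hV : Tendsto V l atTop) (hk : ∀ᶠ a in l, |U a - k a| ≤ 1) :
    Tendsto (fun a => √(2 * Real.pi * V a) * (μ a).real {(k a : ℝ)}) l (𝓝 1) := by
  have hπ := Real.pi_pos
  have hsqrtV : Tendsto (fun a => √(V a)) l atTop := Real.tendsto_sqrt_atTop.comp hV
  -- The inversion integrand after `θ = s / √V`, extended by zero to the whole line. In this scale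
  -- the bound `hdom` becomes a Gaussian in `s` independent of `a`, which serves as the dominating
  -- function.
  let F : ι → ℝ → ℂ := fun a s => Set.indicator (Set.Ioc (-Real.pi * √(V a)) (Real.pi * √(V a)))
    (fun s : ℝ => cexp (-((s / √(V a) : ℝ) * k a * I)) * charFun (μ a) (s / √(V a))) s
  have hF : ∀ᶠ a in l, ((2 * Real.pi * (√(V a) * (μ a).real {(k a : ℝ)}) : ℝ) : ℂ)
      = ∫ s, F a s := by
    filter_upwards [hnat, hV.eventually_gt_atTop 0] with a ha hVa
    have hr : 0 < √(V a) := Real.sqrt_pos.mpr hVa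
    have h := measureReal_singleton_eq_integral_charFun ha (k a)
    have hsub := intervalIntegral.smul_integral_comp_mul_left (a := -Real.pi * √(V a))
      (b := Real.pi * √(V a))
      (fun θ : ℝ => cexp (-(θ * k a * I)) * charFun (μ a) θ) ((√(V a))⁻¹)
    have e1 : (√(V a))⁻¹ * (-Real.pi * √(V a)) = -Real.pi := by field_simp
    have e2 : (√(V a))⁻¹ * (Real.pi * √(V a)) = Real.pi := by field_simp
    rw [e1, e2, ← h] at hsub
    rw [integral_indicator measurableSet_Ioc, ← intervalIntegral.integral_of_le (by nlinarith)]
    have : (∫ s in (-Real.pi * √(V a))..(Real.pi * √(V a)),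
        cexp (-((s / √(V a) : ℝ) * k a * I)) * charFun (μ a) (s / √(V a)))
        = √(V a) • ((√(V a))⁻¹ • ∫ s in (-Real.pi * √(V a))..(Real.pi * √(V a)),
        cexp (-((((√(V a))⁻¹ * s : ℝ) : ℂ) * k a * I)) * charFun (μ a) ((√(V a))⁻¹ * s)) := by
      rw [smul_smul, mul_inv_cancel₀ hr.ne', one_smul]
      simp_rw [div_eq_inv_mul]
    rw [this, hsub]
    simp only [real_smul]
    push_cast
    ring
  have hlim : Tendsto (fun a => ∫ s, F a s) l (𝓝 (∫ s : ℝ, cexp (-(s ^ 2 / 2)))) := by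
    refine tendsto_integral_filter_of_dominated_convergence
      (fun s => Real.exp (-(2 / Real.pi ^ 2) * s ^ 2)) ?_ ?_ ?_ ?_
    · refine Eventually.of_forall fun a => ?_
      refine AEStronglyMeasurable.indicator ?_ measurableSet_Ioc
      refine Continuous.aestronglyMeasurable ?_
      have : Continuous (charFun (μ a)) := continuous_charFun
      fun_prop
    · filter_upwards [hdom, hV.eventually_gt_atTop 0] with a ha hVa
      have hr : 0 < √(V a) := Real.sqrt_pos.mpr hVa
      refine Eventually.of_forall fun s => ?_
      simp only [F]
      by_cases hs : s ∈ Set.Ioc (-Real.pi * √(V a)) (Real.pi * √(V a))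
      · rw [Set.indicator_of_mem hs]
        have h1 : (-((s / √(V a) : ℝ) * k a * I) : ℂ) = ((-(s / √(V a) * k a) : ℝ) : ℂ) * I := by
          push_cast; ring
        have habs : |s / √(V a)| ≤ Real.pi := by
          rw [abs_div, abs_of_pos hr, div_le_iff₀ hr, abs_le]
          exact ⟨by linarith [hs.1], hs.2⟩
        rw [norm_mul, h1, norm_exp_ofReal_mul_I, one_mul]
        refine (ha _ habs).trans (le_of_eq ?_)
        congr 1
        rw [div_pow, Real.sq_sqrt hVa.le]
        field_simp
      · rw [Set.indicator_of_notMem hs, norm_zero]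
        positivity
    · exact integrable_exp_neg_mul_sq (by positivity)
    · refine Eventually.of_forall fun s => ?_
      have hsmall : Tendsto (fun a => |s| / √(V a)) l (𝓝 0) := hsqrtV.const_div_atTop _
      -- Centering at `k` instead of at the mean `U` costs only this phase, since `|U - k|` is
      -- bounded while `√V → ∞`.
      have hphase : Tendsto (fun a => cexp (((s / √(V a) * (U a - k a) : ℝ) : ℂ) * I)) l (𝓝 1) := by
        have : Tendsto (fun a => s / √(V a) * (U a - k a)) l (𝓝 0) := by
          refine squeeze_zero_norm' ?_ hsmall
          filter_upwards [hk] with a ha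
          rw [Real.norm_eq_abs, abs_mul, abs_div, abs_of_nonneg (Real.sqrt_nonneg _)]
          exact mul_le_of_le_one_right (by positivity) ha
        have hcont : Continuous fun x : ℝ => cexp ((x : ℂ) * I) := by fun_prop
        have := (hcont.tendsto 0).comp this
        simpa [Function.comp_def] using this
      have hgauss : Tendsto (fun a => cexp (-((s / √(V a) : ℝ) * U a * I))
          * charFun (μ a) (s / √(V a))) l (𝓝 (cexp (-(s ^ 2 / 2)))) := by
        rw [tendsto_iff_norm_sub_tendsto_zero]
        -- The error `|θ|³ V` of `hclose` at `θ = s / √V`.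
        have h3 : Tendsto (fun a => |s| ^ 3 / √(V a)) l (𝓝 0) := hsqrtV.const_div_atTop _
        refine squeeze_zero' (Eventually.of_forall fun _ => norm_nonneg _) ?_ h3
        filter_upwards [hclose, hV.eventually_gt_atTop 0, hsmall.eventually_lt_const one_pos]
          with a ha hVa h1
        have hr : 0 < √(V a) := Real.sqrt_pos.mpr hVa
        have habs : |s / √(V a)| = |s| / √(V a) := by rw [abs_div, abs_of_pos hr]
        have h := ha (s / √(V a)) (by rw [habs]; exact h1.le)
        have e1 : (((s / √(V a) : ℝ) : ℂ) ^ 2 * V a / 2) = (s : ℂ) ^ 2 / 2 := by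
          have : (s / √(V a)) ^ 2 * V a = s ^ 2 := by
            rw [div_pow, Real.sq_sqrt hVa.le]; field_simp
          rw [← Complex.ofReal_pow, ← Complex.ofReal_mul, this, Complex.ofReal_pow]
        have e2 : |s / √(V a)| ^ 3 * V a = |s| ^ 3 / √(V a) := by
          rw [habs, div_pow]
          nth_rewrite 2 [← Real.sq_sqrt hVa.le]
          field_simp
        rw [e1, e2] at h
        exact h
      have hprod := hphase.mul hgauss
      rw [one_mul] at hprod
      refine hprod.congr' ?_
      have hbig : ∀ᶠ a in l, |s| / √(V a) < Real.pi := hsmall.eventually_lt_const hπ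
      filter_upwards [hV.eventually_gt_atTop 0, hbig] with a hVa hs
      have hr : 0 < √(V a) := Real.sqrt_pos.mpr hVa
      rw [div_lt_iff₀ hr, abs_lt] at hs
      simp only [F]
      rw [Set.indicator_of_mem (Set.mem_Ioc.mpr ⟨by linarith [hs.1], hs.2.le⟩), ← mul_assoc, ← Complex.exp_add]
      congr 2
      push_cast
      ring
  have hgauss : (∫ s : ℝ, cexp (-(s ^ 2 / 2))) = ((√(2 * Real.pi) : ℝ) : ℂ) := by
    have h := integral_gaussian (1 / 2)
    have e : (fun s : ℝ => cexp (-(s ^ 2 / 2)))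
        = fun s : ℝ => ((Real.exp (-(1 / 2) * s ^ 2) : ℝ) : ℂ) := by
      funext s; push_cast; congr 1; ring
    rw [e, integral_complex_ofReal, h]
    congr 2
    field_simp
  rw [hgauss] at hlim
  have hre := ((continuous_re.tendsto _).comp (hlim.congr' (hF.mono fun _ h => h.symm)))
  have hre' := hre.const_mul (√(2 * Real.pi))⁻¹
  have hne : √(2 * Real.pi) ≠ 0 := by positivity
  simp only [Function.comp_def, ofReal_re, inv_mul_cancel₀ hne] at hre'
  refine hre'.congr fun a => ?_
  rw [Real.sqrt_mul (by positivity : 0 ≤ 2 * Real.pi)]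
  field_simp
  rw [Real.sq_sqrt (by positivity)]

end LocalLimit

/-! ### Infinite sums of independent indicators: moments and characteristic functions. -/

/-- A sequence of independent random variables with values in `{0, 1}`. -/
structure IsBernoulliSeq {Ω : Type*} [MeasurableSpace Ω] (X : ℕ → Ω → ℝ) (P : Measure Ω) :
    Prop where
  aemeasurable : ∀ n, AEMeasurable (X n) P
  indep : iIndepFun X P
  zero_or_one : ∀ n ω, X n ω = 0 ∨ X n ω = 1

namespace IsBernoulliSeq

open Complex

variable {Ω : Type*} [MeasurableSpace Ω] {P : Measure Ω} {X : ℕ → Ω → ℝ} {N : Ω → ℝ}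

theorem nonneg (h : IsBernoulliSeq X P) (n : ℕ) (ω : Ω) : 0 ≤ X n ω := by
  rcases h.zero_or_one n ω with h | h <;> simp [h]

theorem le_one (h : IsBernoulliSeq X P) (n : ℕ) (ω : Ω) : X n ω ≤ 1 := by
  rcases h.zero_or_one n ω with h | h <;> simp [h]

theorem aemeasurable_partialSum (h : IsBernoulliSeq X P) (M : ℕ) :
    AEMeasurable (fun ω => ∑ n ∈ Finset.range M, X n ω) P :=
  Finset.aemeasurable_fun_sum _ fun n _ => h.aemeasurable n

/-- The partial sums are natural numbers, and these form a closed subset of `ℝ`. -/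
theorem exists_nat_eq_of_hasSum (h : IsBernoulliSeq X P) {ω : Ω} (hω : HasSum (X · ω) (N ω)) :
    ∃ n : ℕ, N ω = n := by
  have hmem : ∀ M, ∑ n ∈ Finset.range M, X n ω ∈ Set.range ((↑) : ℕ → ℝ) := by
    intro M
    induction M with
    | zero => exact ⟨0, by simp⟩
    | succ M ih =>
      obtain ⟨m, hm⟩ := ih
      rw [Finset.sum_range_succ, ← hm]
      rcases h.zero_or_one M ω with h | h
      · exact ⟨m, by simp [h]⟩
      · exact ⟨m + 1, by simp [h]⟩
  obtain ⟨n, hn⟩ := Nat.isClosedEmbedding_coe_real.isClosed_range.mem_of_tendsto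
    hω.tendsto_sum_nat (Eventually.of_forall hmem)
  exact ⟨n, hn.symm⟩

theorem mean_nonneg (h : IsBernoulliSeq X P) (n : ℕ) : 0 ≤ P[X n] :=
  integral_nonneg (h.nonneg n)

theorem aemeasurable_sum (h : IsBernoulliSeq X P) (hN : ∀ᵐ ω ∂P, HasSum (X · ω) (N ω)) :
    AEMeasurable N P :=
  aemeasurable_of_tendsto_metrizable_ae atTop h.aemeasurable_partialSum
    (hN.mono fun _ hω => hω.tendsto_sum_nat)

theorem partialSum_le (h : IsBernoulliSeq X P) {ω : Ω} (hω : HasSum (X · ω) (N ω)) (M : ℕ) :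
    ∑ n ∈ Finset.range M, X n ω ≤ N ω :=
  sum_le_hasSum _ (fun n _ => h.nonneg n ω) hω

variable [IsProbabilityMeasure P]

theorem memLp (h : IsBernoulliSeq X P) (n : ℕ) (q : ℝ≥0∞) : MemLp (X n) q P :=
  MemLp.of_bound (h.aemeasurable n).aestronglyMeasurable 1 (Eventually.of_forall fun ω => by
    rw [Real.norm_eq_abs, abs_of_nonneg (h.nonneg n ω)]; exact h.le_one n ω)

theorem integrable (h : IsBernoulliSeq X P) (n : ℕ) : Integrable (X n) P :=
  memLp_one_iff_integrable.mp (h.memLp n 1)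

theorem mean_le_one (h : IsBernoulliSeq X P) (n : ℕ) : P[X n] ≤ 1 := by
  simpa using integral_mono (h.integrable n) (integrable_const (1 : ℝ)) (h.le_one n)

theorem variance_eq (h : IsBernoulliSeq X P) (n : ℕ) :
    Var[X n; P] = P[X n] * (1 - P[X n]) := by
  have hsq : X n ^ 2 = X n := by
    funext ω
    rcases h.zero_or_one n ω with h | h <;> simp [h]
  rw [variance_eq_sub (h.memLp n 2), hsq]
  ring

theorem charFun_map (h : IsBernoulliSeq X P) (n : ℕ) (θ : ℝ) :
    charFun (P.map (X n)) θ = 1 - (P[X n] : ℝ) + (P[X n] : ℝ) * cexp (θ * I) := by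
  rw [charFun_apply_real, integral_map (h.aemeasurable n) (by fun_prop)]
  have e : ∀ ω, cexp (θ * X n ω * I) = 1 + (X n ω : ℂ) * (cexp (θ * I) - 1) := by
    intro ω
    rcases h.zero_or_one n ω with h | h <;> simp [h]
  simp_rw [e]
  rw [integral_add (integrable_const _) ((h.integrable n).ofReal.mul_const _),
    integral_mul_const, integral_complex_ofReal]
  simp
  ring

theorem charFun_map_partialSum (h : IsBernoulliSeq X P) (M : ℕ) (θ : ℝ) :
    charFun (P.map fun ω => ∑ n ∈ Finset.range M, X n ω) θ
      = ∏ n ∈ Finset.range M, (1 - (P[X n] : ℝ) + (P[X n] : ℝ) * cexp (θ * I)) := by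
  rw [(h.indep.restrict _).charFun_map_fun_finsetSum_eq_prod (fun n _ => h.aemeasurable n), Finset.prod_apply]
  exact Finset.prod_congr rfl fun n _ => h.charFun_map n θ

/-- Lets the finite-product estimates pass to the infinite sum. -/
theorem tendsto_charFun_map_partialSum (h : IsBernoulliSeq X P)
    (hN : ∀ᵐ ω ∂P, HasSum (X · ω) (N ω)) (θ : ℝ) :
    Tendsto (fun M => charFun (P.map fun ω => ∑ n ∈ Finset.range M, X n ω) θ) atTop
      (𝓝 (charFun (P.map N) θ)) := by
  simp_rw [charFun_apply_real]
  rw [integral_map (h.aemeasurable_sum hN) (by fun_prop)]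
  simp_rw [fun M => integral_map (h.aemeasurable_partialSum M) (μ := P)
    (f := fun x : ℝ => cexp (θ * x * I)) (by fun_prop)]
  refine tendsto_integral_of_dominated_convergence (fun _ => 1) (fun M => ?_)
    (integrable_const _) (fun M => Eventually.of_forall fun ω => ?_) ?_
  · have hc : Continuous fun x : ℝ => cexp (θ * x * I) := by fun_prop
    exact (hc.measurable.comp_aemeasurable (h.aemeasurable_partialSum M)).aestronglyMeasurable
  · rw [← ofReal_mul, norm_exp_ofReal_mul_I]
  · filter_upwards [hN] with ω hω
    have hc : Continuous fun x : ℝ => cexp (θ * x * I) := by fun_prop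
    exact (hc.tendsto _).comp hω.tendsto_sum_nat

theorem summable_variance (h : IsBernoulliSeq X P) (hs : Summable fun n => P[X n]) :
    Summable fun n => P[X n] * (1 - P[X n]) :=
  hs.of_nonneg_of_le
    (fun n => mul_nonneg (h.mean_nonneg n) (sub_nonneg.mpr (h.mean_le_one n)))
    (fun n => mul_le_of_le_one_right (h.mean_nonneg n) (by linarith [h.mean_nonneg n]))

theorem norm_charFun_map_le (h : IsBernoulliSeq X P) (hs : Summable fun n => P[X n])
    (hN : ∀ᵐ ω ∂P, HasSum (X · ω) (N ω)) {θ : ℝ} (hθ : |θ| ≤ Real.pi) :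
    ‖charFun (P.map N) θ‖
      ≤ Real.exp (-(2 / Real.pi ^ 2 * θ ^ 2 * ∑' n, P[X n] * (1 - P[X n]))) := by
  have hlim : Tendsto (fun M => Real.exp (-(2 / Real.pi ^ 2 * θ ^ 2 *
      ∑ n ∈ Finset.range M, P[X n] * (1 - P[X n])))) atTop
      (𝓝 (Real.exp (-(2 / Real.pi ^ 2 * θ ^ 2 * ∑' n, P[X n] * (1 - P[X n]))))) :=
    (Real.continuous_exp.tendsto _).comp
      (((h.summable_variance hs).hasSum.tendsto_sum_nat.const_mul _).neg)
  refine le_of_tendsto_of_tendsto' (h.tendsto_charFun_map_partialSum hN θ).norm hlim fun M => ?_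
  rw [h.charFun_map_partialSum, Finset.mul_sum, ← Finset.sum_neg_distrib, Real.exp_sum, norm_prod]
  exact Finset.prod_le_prod (fun _ _ => norm_nonneg _) fun n _ =>
    norm_bernoulli_charFun_le (h.mean_nonneg n) (h.mean_le_one n) hθ

theorem norm_centered_charFun_map_sub_le (h : IsBernoulliSeq X P) (hs : Summable fun n => P[X n])
    (hN : ∀ᵐ ω ∂P, HasSum (X · ω) (N ω)) {θ : ℝ} (hθ : |θ| ≤ 1) :
    ‖cexp (-(θ * (∑' n, P[X n] : ℝ) * I)) * charFun (P.map N) θ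
        - cexp (-(θ ^ 2 * (∑' n, P[X n] * (1 - P[X n]) : ℝ) / 2))‖
      ≤ |θ| ^ 3 * ∑' n, P[X n] * (1 - P[X n]) := by
  have hV := (h.summable_variance hs).hasSum.tendsto_sum_nat
  have hU := hs.hasSum.tendsto_sum_nat
  have c1 : Continuous fun u : ℝ => cexp (-(θ * u * I)) := by fun_prop
  have c2 : Continuous fun v : ℝ => cexp (-(θ ^ 2 * v / 2)) := by fun_prop
  have hlim := ((((c1.tendsto _).comp hU).mul (h.tendsto_charFun_map_partialSum hN θ)).sub
    ((c2.tendsto _).comp hV)).norm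
  refine le_of_tendsto_of_tendsto' hlim (hV.const_mul (|θ| ^ 3)) fun M => ?_
  simp only [Function.comp_apply]
  rw [h.charFun_map_partialSum]
  have e1 : cexp (-(θ * (∑ n ∈ Finset.range M, P[X n] : ℝ) * I))
      = ∏ n ∈ Finset.range M, cexp (-(θ * (P[X n] : ℝ) * I)) := by
    rw [← Complex.exp_sum, ofReal_sum, Finset.mul_sum, Finset.sum_mul, Finset.sum_neg_distrib]
  have e2 : cexp (-(θ ^ 2 * (∑ n ∈ Finset.range M, P[X n] * (1 - P[X n]) : ℝ) / 2))
      = ∏ n ∈ Finset.range M,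
        cexp (-(θ ^ 2 * ((P[X n] : ℝ) * (1 - (P[X n] : ℝ))) / 2)) := by
    rw [← Complex.exp_sum, ofReal_sum, Finset.mul_sum, Finset.sum_div, Finset.sum_neg_distrib]
    push_cast
    rfl
  rw [e1, e2, ← Finset.prod_mul_distrib, Finset.mul_sum]
  refine (Finset.norm_prod_sub_prod_le_sum _ _ _ (fun n _ => ?_) (fun n _ => ?_)).trans
    (Finset.sum_le_sum fun n _ =>
      norm_centered_bernoulli_charFun_sub_le (h.mean_nonneg n) (h.mean_le_one n) hθ)
  · have : (-(θ * (P[X n] : ℝ) * I) : ℂ) = ((-(θ * P[X n]) : ℝ) : ℂ) * I := by push_cast; ring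
    rw [norm_mul, this, norm_exp_ofReal_mul_I, one_mul, ← h.charFun_map]
    have := Measure.isProbabilityMeasure_map (μ := P) (h.aemeasurable n)
    exact norm_charFun_le_one θ
  · have : (-(θ ^ 2 * ((P[X n] : ℝ) * (1 - (P[X n] : ℝ))) / 2) : ℂ)
        = ((-(θ ^ 2 * (P[X n] * (1 - P[X n])) / 2) : ℝ) : ℂ) := by push_cast; ring
    rw [this, ← ofReal_exp, norm_real, Real.norm_eq_abs, Real.abs_exp, Real.exp_le_one_iff]
    have := mul_nonneg (h.mean_nonneg n) (sub_nonneg.mpr (h.mean_le_one n))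
    have := mul_nonneg (sq_nonneg θ) this
    linarith

theorem mean_partialSum (h : IsBernoulliSeq X P) (M : ℕ) :
    ∫ ω, ∑ n ∈ Finset.range M, X n ω ∂P = ∑ n ∈ Finset.range M, P[X n] :=
  integral_finsetSum _ fun n _ => h.integrable n

theorem memLp_partialSum (h : IsBernoulliSeq X P) (M : ℕ) :
    MemLp (fun ω => ∑ n ∈ Finset.range M, X n ω) 2 P :=
  memLp_finsetSum _ fun n _ => h.memLp n 2

theorem integral_sq_partialSum (h : IsBernoulliSeq X P) (M : ℕ) :
    ∫ ω, (∑ n ∈ Finset.range M, X n ω) ^ 2 ∂P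
      = ∑ n ∈ Finset.range M, P[X n] * (1 - P[X n]) + (∑ n ∈ Finset.range M, P[X n]) ^ 2 := by
  have h1 := variance_eq_sub (h.memLp_partialSum M)
  have h2 : Var[fun ω => ∑ n ∈ Finset.range M, X n ω; P]
      = ∑ n ∈ Finset.range M, P[X n] * (1 - P[X n]) := by
    have := IndepFun.variance_sum (s := Finset.range M) (fun n _ => h.memLp n 2)
      (fun i _ j _ hij => h.indep.indepFun hij)
    rw [Finset.sum_congr rfl fun n _ => h.variance_eq n] at this
    rw [← this]
    congr 1
    funext ω
    simp
  rw [h2, h.mean_partialSum] at h1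
  simp only [Pi.pow_apply] at h1
  linarith

/-- Fatou's lemma: the second moments of the partial sums, variance plus squared mean, stay below `V
+ U²`. This then supplies the dominating functions `N` and `N²` for computing the mean and the
variance. -/
theorem memLp_sum (h : IsBernoulliSeq X P) (hs : Summable fun n => P[X n])
    (hN : ∀ᵐ ω ∂P, HasSum (X · ω) (N ω)) : MemLp N 2 P := by
  have hNm := h.aemeasurable_sum hN
  rw [memLp_two_iff_integrable_sq hNm.aestronglyMeasurable, ← memLp_one_iff_integrable]
  refine ⟨(hNm.pow_const 2).aestronglyMeasurable, ?_⟩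
  have hfatou := Lp.eLpNorm_lim_le_liminf_eLpNorm (p := 1) (μ := P)
    (f := fun M ω => (∑ n ∈ Finset.range M, X n ω) ^ 2)
    (fun M => ((h.aemeasurable_partialSum M).pow_const 2).aestronglyMeasurable) (fun ω => N ω ^ 2)
    (hN.mono fun ω hω => hω.tendsto_sum_nat.pow 2)
  refine hfatou.trans_lt (lt_of_le_of_lt (b := ENNReal.ofReal
    (∑' n, P[X n] * (1 - P[X n]) + (∑' n, P[X n]) ^ 2)) ?_ ENNReal.ofReal_lt_top)
  refine liminf_le_of_frequently_le' (Eventually.of_forall fun M => ?_).frequently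
  rw [eLpNorm_one_eq_lintegral_enorm, ← ofReal_integral_norm_eq_lintegral_enorm
    (h.memLp_partialSum M).integrable_sq]
  refine ENNReal.ofReal_le_ofReal ?_
  simp only [norm_pow, Real.norm_eq_abs, sq_abs]
  rw [h.integral_sq_partialSum]
  have hv0 : ∀ n, 0 ≤ P[X n] * (1 - P[X n]) := fun n =>
    mul_nonneg (h.mean_nonneg n) (sub_nonneg.mpr (h.mean_le_one n))
  have := hs.sum_le_tsum (Finset.range M) fun n _ => h.mean_nonneg n
  have := (h.summable_variance hs).sum_le_tsum (Finset.range M) fun n _ => hv0 n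
  have := Finset.sum_nonneg (s := Finset.range M) fun n _ => h.mean_nonneg n
  gcongr

theorem mean_sum (h : IsBernoulliSeq X P) (hs : Summable fun n => P[X n])
    (hN : ∀ᵐ ω ∂P, HasSum (X · ω) (N ω)) : P[N] = ∑' n, P[X n] := by
  refine tendsto_nhds_unique ?_ hs.hasSum.tendsto_sum_nat
  simp_rw [← h.mean_partialSum]
  refine tendsto_integral_of_dominated_convergence N
    (fun M => (h.aemeasurable_partialSum M).aestronglyMeasurable)
    ((h.memLp_sum hs hN).integrable one_le_two) (fun M => ?_)
    (hN.mono fun _ hω => hω.tendsto_sum_nat)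
  filter_upwards [hN] with ω hω
  rw [Real.norm_eq_abs, abs_of_nonneg (Finset.sum_nonneg fun n _ => h.nonneg n ω)]
  exact h.partialSum_le hω M

theorem variance_sum (h : IsBernoulliSeq X P) (hs : Summable fun n => P[X n])
    (hN : ∀ᵐ ω ∂P, HasSum (X · ω) (N ω)) : Var[N; P] = ∑' n, P[X n] * (1 - P[X n]) := by
  have hsq : Tendsto (fun M => ∫ ω, (∑ n ∈ Finset.range M, X n ω) ^ 2 ∂P) atTop
      (𝓝 (∫ ω, N ω ^ 2 ∂P)) := by
    refine tendsto_integral_of_dominated_convergence (fun ω => N ω ^ 2)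
      (fun M => ((h.aemeasurable_partialSum M).pow_const 2).aestronglyMeasurable)
      (h.memLp_sum hs hN).integrable_sq (fun M => ?_)
      (hN.mono fun _ hω => hω.tendsto_sum_nat.pow 2)
    filter_upwards [hN] with ω hω
    have h0 := Finset.sum_nonneg (s := Finset.range M) fun n _ => h.nonneg n ω
    rw [Real.norm_eq_abs, abs_of_nonneg (sq_nonneg _)]
    exact pow_le_pow_left₀ h0 (h.partialSum_le hω M) 2
  simp_rw [h.integral_sq_partialSum] at hsq
  have hlim := (h.summable_variance hs).hasSum.tendsto_sum_nat.add
    (hs.hasSum.tendsto_sum_nat.pow 2)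
  have := tendsto_nhds_unique hsq hlim
  rw [variance_eq_sub (h.memLp_sum hs hN), h.mean_sum hs hN]
  simp only [Pi.pow_apply]
  linarith

end IsBernoulliSeq

/-- A local limit theorem for sums of independent indicators with diverging variances. -/
theorem tendsto_sqrt_variance_mul_measureReal {Ω ι : Type*} [MeasurableSpace Ω] {P : Measure Ω}
    [IsProbabilityMeasure P] {l : Filter ι} [l.IsCountablyGenerated] {X : ι → ℕ → Ω → ℝ}
    {N : ι → Ω → ℝ} {k : ι → ℕ} (hX : ∀ᶠ a in l, IsBernoulliSeq (X a) P)
    (hs : ∀ᶠ a in l, Summable fun n => P[X a n])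
    (hN : ∀ᶠ a in l, ∀ᵐ ω ∂P, HasSum (X a · ω) (N a ω)) (hNm : ∀ a, AEMeasurable (N a) P)
    (hV : Tendsto (fun a => Var[N a; P]) l atTop) (hk : ∀ᶠ a in l, |P[N a] - (k a : ℝ)| ≤ 1) :
    Tendsto (fun a => √(2 * Real.pi * Var[N a; P]) * P.real {ω | N a ω = k a}) l (𝓝 1) := by
  have inst : ∀ a, IsProbabilityMeasure (P.map (N a)) := fun a =>
    Measure.isProbabilityMeasure_map (hNm a)
  have key := tendsto_sqrt_mul_measureReal_singleton (μ := fun a => P.map (N a))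
    (U := fun a => P[N a]) (V := fun a => Var[N a; P]) (k := k) (l := l) ?_ ?_ ?_ hV hk
  · refine key.congr fun a => ?_
    rw [map_measureReal_apply_of_aemeasurable (hNm a) (measurableSet_singleton _)]
    rfl
  · filter_upwards [hX, hN] with a hXa hNa
    have hms : MeasurableSet {x : ℝ | ∃ n : ℕ, x = n} := by
      have : {x : ℝ | ∃ n : ℕ, x = n} = Set.range ((↑) : ℕ → ℝ) := by
        ext x; simp [eq_comm]
      rw [this]
      exact (Set.countable_range _).measurableSet
    rw [ae_map_iff (hNm a) hms]
    filter_upwards [hNa] with ω hω using hXa.exists_nat_eq_of_hasSum hω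
  · filter_upwards [hX, hs, hN] with a hXa hsa hNa θ hθ
    rw [hXa.variance_sum hsa hNa]
    exact hXa.norm_charFun_map_le hsa hNa hθ
  · filter_upwards [hX, hs, hN] with a hXa hsa hNa θ hθ
    rw [hXa.variance_sum hsa hNa, hXa.mean_sum hsa hNa]
    exact hXa.norm_centered_charFun_map_sub_le hsa hNa hθ

/-! ### Spreading of convolution powers of a nondegenerate law. -/

section Concentration

open Complex

/-- Modulus `1` at `s` forces `e^{isz}` to be constant almost everywhere, hence on the support by
closedness. Two distinct support points `x`, `y` then give `s (x - y) ∈ 2πℤ`. Lattice and nonlattice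
laws are thus treated alike. -/
theorem countable_setOf_one_le_norm_charFun {μ : Measure ℝ} [IsProbabilityMeasure μ]
    (hμ : ¬ ∃ c : ℝ, ∀ᵐ x ∂μ, x = c) : {s : ℝ | 1 ≤ ‖charFun μ s‖}.Countable := by
  obtain ⟨x, hx⟩ : μ.support.Nonempty := Measure.nonempty_support (IsProbabilityMeasure.ne_zero μ)
  obtain ⟨y, hy, hxy⟩ : ∃ y ∈ μ.support, y ≠ x := by
    by_contra! hall
    exact hμ ⟨x, by filter_upwards [Measure.support_mem_ae (μ := μ)] with y hy using hall y hy⟩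
  refine (Set.countable_range fun n : ℤ => 2 * Real.pi * n / (x - y)).mono fun s hs => ?_
  have hbound : ∀ᵐ z : ℝ ∂μ, ‖cexp (s * z * I)‖ ≤ 1 := Eventually.of_forall fun z => by
    rw [← ofReal_mul, norm_exp_ofReal_mul_I]
  rcases ae_eq_const_or_norm_integral_lt_of_norm_le_const hbound with h | h
  · have hclosed : IsClosed {z : ℝ | cexp (s * z * I) = ⨍ x : ℝ, cexp (s * x * I) ∂μ} :=
      isClosed_eq (by fun_prop) continuous_const
    have hsub := Measure.support_subset_of_isClosed hclosed h
    have hexp : cexp (s * x * I) = cexp (s * y * I) := (hsub hx).trans (hsub hy).symm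
    obtain ⟨n, hn⟩ := Complex.exp_eq_exp_iff_exists_int.mp hexp
    refine ⟨n, ?_⟩
    have hsn : (s : ℂ) * (x - y) = 2 * Real.pi * n := by
      apply mul_right_cancel₀ I_ne_zero
      linear_combination hn
    have hsn' : s * (x - y) = 2 * Real.pi * n := by exact_mod_cast hsn
    simp only [← hsn']
    exact mul_div_cancel_right₀ s (sub_ne_zero.mpr hxy.symm)
  · rw [← charFun_apply_real] at h
    simp only [probReal_univ, mul_one] at h
    exact absurd hs (not_le.mpr h)

/-- On the ball, `exp (-((z - a) / r)² / 2)` is at least `exp (-1/2)`. This function is itself the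
characteristic function of a standard Gaussian at `(z - a) / r`, so Fubini turns its `μ`-integral
into a Gaussian average of `charFun μ`. The centre `a` enters only through a phase, which makes the
bound uniform in `a`. -/
theorem measureReal_closedBall_le_integral_norm_charFun {μ : Measure ℝ} [IsProbabilityMeasure μ]
    (a : ℝ) {r : ℝ} (hr : 0 < r) :
    μ.real (Metric.closedBall a r)
      ≤ Real.exp (1 / 2) * ∫ g, ‖charFun μ (g / r)‖ ∂(gaussianReal 0 1) := by
  have hint : Integrable (Function.uncurry fun (z g : ℝ) => cexp (((z - a) / r : ℝ) * g * I))
      (μ.prod (gaussianReal 0 1)) := by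
    refine Integrable.of_bound (C := 1) ?_ (Eventually.of_forall fun z => ?_)
    · exact Continuous.aestronglyMeasurable (by unfold Function.uncurry; fun_prop)
    · simp only [Function.uncurry]
      rw [← ofReal_mul, norm_exp_ofReal_mul_I]
  have hgauss : ∀ z : ℝ, ∫ g, cexp (((z - a) / r : ℝ) * g * I) ∂(gaussianReal 0 1)
      = ((Real.exp (-((z - a) / r) ^ 2 / 2) : ℝ) : ℂ) := by
    intro z
    rw [← charFun_apply_real, charFun_gaussianReal]
    push_cast
    congr 1
    ring
  have hfubini : ((∫ z, Real.exp (-((z - a) / r) ^ 2 / 2) ∂μ : ℝ) : ℂ)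
      = ∫ g, cexp (((-(a / r * g) : ℝ) : ℂ) * I) * charFun μ (g / r) ∂(gaussianReal 0 1) := by
    rw [← integral_complex_ofReal]
    simp_rw [← hgauss]
    rw [integral_integral_swap hint]
    congr 1
    funext g
    rw [charFun_apply_real, ← integral_const_mul]
    congr 1
    funext z
    rw [← Complex.exp_add]
    congr 1
    push_cast
    ring
  have hle : ∫ z, Real.exp (-((z - a) / r) ^ 2 / 2) ∂μ
      ≤ ∫ g, ‖charFun μ (g / r)‖ ∂(gaussianReal 0 1) := by
    refine (le_abs_self _).trans ?_
    rw [← Real.norm_eq_abs, ← Complex.norm_real, hfubini]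
    refine (norm_integral_le_integral_norm _).trans (le_of_eq ?_)
    congr 1
    funext g
    rw [norm_mul, norm_exp_ofReal_mul_I, one_mul]
  have hlow : Real.exp (-(1 / 2)) * μ.real (Metric.closedBall a r)
      ≤ ∫ z, Real.exp (-((z - a) / r) ^ 2 / 2) ∂μ := by
    have hle1 : ∀ z : ℝ, Real.exp (-((z - a) / r) ^ 2 / 2) ≤ 1 := fun z => by
      rw [Real.exp_le_one_iff]
      linarith [sq_nonneg ((z - a) / r)]
    have hint' : Integrable (fun z => Real.exp (-((z - a) / r) ^ 2 / 2)) μ :=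
      Integrable.of_bound (C := 1) (Continuous.aestronglyMeasurable (by fun_prop))
        (Eventually.of_forall fun z => by
          rw [Real.norm_eq_abs, Real.abs_exp]; exact hle1 z)
    have hmem : ∀ z ∈ Metric.closedBall a r,
        Real.exp (-(1 / 2)) ≤ Real.exp (-((z - a) / r) ^ 2 / 2) := fun z hz => by
      rw [Metric.mem_closedBall, Real.dist_eq] at hz
      have : ((z - a) / r) ^ 2 ≤ 1 := by
        rw [sq_le_one_iff_abs_le_one, abs_div, abs_of_pos hr]
        exact (div_le_one hr).mpr hz
      exact Real.exp_le_exp.mpr (by linarith)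
    calc _ = ∫ z in Metric.closedBall a r, Real.exp (-(1 / 2)) ∂μ := by
          rw [setIntegral_const, smul_eq_mul, mul_comm]
      _ ≤ ∫ z in Metric.closedBall a r, Real.exp (-((z - a) / r) ^ 2 / 2) ∂μ :=
          setIntegral_mono_on (integrable_const _).integrableOn hint'.integrableOn
            Metric.isClosed_closedBall.measurableSet hmem
      _ ≤ _ := setIntegral_le_integral hint' (Eventually.of_forall fun z => (Real.exp_pos _).le)
  calc μ.real (Metric.closedBall a r)
      = Real.exp (1 / 2) * (Real.exp (-(1 / 2)) * μ.real (Metric.closedBall a r)) := by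
        rw [← mul_assoc, ← Real.exp_add]; simp
    _ ≤ _ := by gcongr; exact hlow.trans hle

/-- The exceptional countable set is Gaussian-null, so the powers tend to `0` almost everywhere and
are bounded by `1`. -/
theorem tendsto_integral_norm_charFun_pow {μ : Measure ℝ} [IsProbabilityMeasure μ]
    (hμ : ¬ ∃ c : ℝ, ∀ᵐ x ∂μ, x = c) {r : ℝ} (hr : 0 < r) :
    Tendsto (fun n : ℕ => ∫ g, ‖charFun μ (g / r) ^ n‖ ∂(gaussianReal 0 1)) atTop (𝓝 0) := by
  have hcont : Continuous (charFun μ) := continuous_charFun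
  have hlt : ∀ᵐ g ∂(gaussianReal 0 1), ‖charFun μ (g / r)‖ < 1 := by
    have := nullSingletonClass_gaussianReal (μ := 0) (v := 1) one_ne_zero
    have hc : ((fun g : ℝ => g / r) ⁻¹' {s : ℝ | 1 ≤ ‖charFun μ s‖}).Countable :=
      (countable_setOf_one_le_norm_charFun hμ).preimage fun x y hxy =>
        (div_left_inj' hr.ne').mp hxy
    filter_upwards [hc.ae_notMem (gaussianReal 0 1)] with g hg
    simpa using hg
  have h := tendsto_integral_of_dominated_convergence (μ := gaussianReal 0 1)
    (F := fun (n : ℕ) (g : ℝ) => ‖charFun μ (g / r) ^ n‖) (f := fun _ => (0 : ℝ)) (fun _ => 1)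
    (fun n => Continuous.aestronglyMeasurable (by fun_prop)) (integrable_const _)
    (fun n => Eventually.of_forall fun g => by
      rw [norm_norm, norm_pow]
      exact pow_le_one₀ (norm_nonneg _) (norm_charFun_le_one _))
    (by
      filter_upwards [hlt] with g hg
      simp_rw [norm_pow]
      exact tendsto_pow_atTop_nhds_zero_of_lt_one (norm_nonneg _) hg)
  simpa using h

end Concentration

/-! ### A lower bound for the variance in terms of the jumps. -/

section VarianceLowerBound

/-- If a summable nonincreasing sequence in `[0, 1]` that starts above `1 / 2` has small jumps,
then `∑ q (1 - q)` is large. -/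
theorem one_div_le_mul_tsum_mul_one_sub {q : ℕ → ℝ} {ε : ℝ} (hq0 : ∀ n, 0 ≤ q n)
    (hq1 : ∀ n, q n ≤ 1) (hanti : Antitone q) (hsum : Summable q) (hε : 0 ≤ ε)
    (hjump : ∀ n, q n - q (n + 1) ≤ ε) (hstart : 1 / 2 ≤ q 0) :
    1 / 12 ≤ ε * (∑' n, q n * (1 - q n) + 1) := by
  have hsumV : Summable fun n => q n * (1 - q n) :=
    hsum.of_nonneg_of_le (fun n => mul_nonneg (hq0 n) (sub_nonneg.mpr (hq1 n)))
      (fun n => mul_le_of_le_one_right (hq0 n) (by linarith [hq0 n]))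
  -- Here `G(x) = x² / 2 - x³ / 3` is an antiderivative of `x (1 - x)`: the left side is the
  -- integral over one jump. The extra term `ε * (q n - q (n + 1))` pays for evaluating the
  -- integrand at an endpoint, and telescopes to at most `ε`.
  have hstep : ∀ n, (q n ^ 2 / 2 - q n ^ 3 / 3) - (q (n + 1) ^ 2 / 2 - q (n + 1) ^ 3 / 3)
      ≤ ε * (q n * (1 - q n)) + ε * (q n - q (n + 1)) := by
    intro n
    obtain ⟨d, hd⟩ : ∃ d, q (n + 1) = q n - d := ⟨q n - q (n + 1), by ring⟩
    have hd0 : 0 ≤ d := by linarith [hanti n.le_succ]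
    have hdε : d ≤ ε := by linarith [hjump n]
    have hx0 := hq0 n
    have hx1 := hq1 n
    rw [hd]
    have h1 : q n * d ≤ d := mul_le_of_le_one_left hd0 hx1
    have h2 : q n - d / 2 - q n ^ 2 + q n * d - d ^ 2 / 3 ≤ q n * (1 - q n) + d := by
      nlinarith [sq_nonneg d]
    have h3 : 0 ≤ q n * (1 - q n) + d :=
      add_nonneg (mul_nonneg hx0 (sub_nonneg.mpr hx1)) hd0
    calc _ = d * (q n - d / 2 - q n ^ 2 + q n * d - d ^ 2 / 3) := by ring
      _ ≤ d * (q n * (1 - q n) + d) := by gcongr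
      _ ≤ ε * (q n * (1 - q n) + d) := by gcongr
      _ = _ := by ring
  have htel : ∀ M, (q 0 ^ 2 / 2 - q 0 ^ 3 / 3) - (q M ^ 2 / 2 - q M ^ 3 / 3)
      ≤ ε * ∑ n ∈ Finset.range M, q n * (1 - q n) + ε * (q 0 - q M) := by
    intro M
    induction M with
    | zero => simp
    | succ M ih =>
      rw [Finset.sum_range_succ]
      linarith [hstep M]
  have hlim := hsum.tendsto_atTop_zero
  have h := le_of_tendsto_of_tendsto'
    ((((hlim.pow 2).div_const 2).sub ((hlim.pow 3).div_const 3)).const_sub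
      (q 0 ^ 2 / 2 - q 0 ^ 3 / 3))
    ((hsumV.hasSum.tendsto_sum_nat.const_mul ε).add ((hlim.const_sub (q 0)).const_mul ε)) htel
  norm_num at h
  have h0 : ε * q 0 ≤ ε := mul_le_of_le_one_right hε (hq1 0)
  -- `G` increases on `[0, 1]` and `G(1/2) = 1/12`, whence the constant.
  nlinarith [hq1 0, sq_nonneg (q 0 - 1 / 2), mul_nonneg (hq0 0) (sq_nonneg (q 0 - 1 / 2))]

end VarianceLowerBound

/-! ### The random walk: summability, monotonicity and small jumps in `n`. -/

section RandomWalk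

variable {Ω₀ Ω : Type*} [MeasurableSpace Ω₀] [MeasurableSpace Ω] {P₀ : Measure Ω₀}
  {P : Measure Ω} {ξ : Ω₀ → ℝ} {ξs : ℕ → Ω → ℝ}

namespace IsIndepCopies

theorem aemeasurable (h : IsIndepCopies ξ P₀ ξs P) (k : ℕ) : AEMeasurable (ξs k) P :=
  (h.law k).aemeasurable_fst

theorem aemeasurable_randomWalk (h : IsIndepCopies ξ P₀ ξs P) (n : ℕ) :
    AEMeasurable (randomWalk ξs n) P :=
  Finset.aemeasurable_fun_sum _ fun k _ => h.aemeasurable k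

theorem ae_nonneg (h : IsIndepCopies ξ P₀ ξs P) (hξ : ∀ᵐ ω ∂P₀, 0 ≤ ξ ω) (k : ℕ) :
    ∀ᵐ ω ∂P, 0 ≤ ξs k ω :=
  (h.law k).symm.ae_snd measurableSet_Ici hξ

theorem charFun_map_randomWalk [IsProbabilityMeasure P] (h : IsIndepCopies ξ P₀ ξs P) (n : ℕ)
    (s : ℝ) : charFun (P.map (randomWalk ξs n)) s = charFun (P₀.map ξ) s ^ (n + 1) := by
  have : randomWalk ξs n = fun ω => ∑ k ∈ Finset.range (n + 1), ξs k ω := rfl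
  rw [this, (h.indep.restrict _).charFun_map_fun_finsetSum_eq_prod (fun k _ => h.aemeasurable k),
    Finset.prod_apply, Finset.prod_congr rfl fun k _ => by rw [(h.law k).map_eq]]
  simp

theorem mgf_randomWalk [IsProbabilityMeasure P] (h : IsIndepCopies ξ P₀ ξs P) (n : ℕ) (s : ℝ) :
    mgf (randomWalk ξs n) P s = mgf ξ P₀ s ^ (n + 1) := by
  have : randomWalk ξs n = ∑ k ∈ Finset.range (n + 1), ξs k := by
    funext ω; simp [randomWalk]
  rw [this, h.indep.mgf_sum₀ h.aemeasurable,
    Finset.prod_congr rfl fun k _ => mgf_congr_of_identDistrib (ξs k) ξ (h.law k) s]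
  simp

theorem ae_randomWalk_nonneg (h : IsIndepCopies ξ P₀ ξs P) (hξ : ∀ᵐ ω ∂P₀, 0 ≤ ξ ω) (n : ℕ) :
    ∀ᵐ ω ∂P, 0 ≤ randomWalk ξs n ω := by
  filter_upwards [ae_all_iff.mpr (h.ae_nonneg hξ)] with ω hω
  exact Finset.sum_nonneg fun k _ => hω k

end IsIndepCopies

theorem randomWalk_succ {Ω : Type*} (ξs : ℕ → Ω → ℝ) (n : ℕ) (ω : Ω) :
    randomWalk ξs (n + 1) ω = randomWalk ξs n ω + ξs (n + 1) ω :=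
  Finset.sum_range_succ _ _

/-- Equality would force `ξ = 0` almost surely, a degenerate law. -/
theorem mgf_neg_one_lt_one [IsProbabilityMeasure P₀] (hm : AEMeasurable ξ P₀)
    (hξ : ∀ᵐ ω ∂P₀, 0 ≤ ξ ω) (hdeg : ¬ ∃ c : ℝ, ∀ᵐ ω ∂P₀, ξ ω = c) : mgf ξ P₀ (-1) < 1 := by
  have hle : ∀ᵐ ω ∂P₀, Real.exp (-1 * ξ ω) ≤ 1 := by
    filter_upwards [hξ] with ω hω
    rw [Real.exp_le_one_iff]
    linarith
  have hint : Integrable (fun ω => Real.exp (-1 * ξ ω)) P₀ :=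
    Integrable.of_bound (C := 1) (by fun_prop) (hle.mono fun ω hω => by
      rwa [Real.norm_eq_abs, Real.abs_exp])
  have hle' : mgf ξ P₀ (-1) ≤ 1 := by
    simpa [mgf] using integral_mono_ae hint (integrable_const (1 : ℝ)) hle
  refine lt_of_le_of_ne hle' fun heq => hdeg ⟨0, ?_⟩
  have hzero : ∫ ω, (1 - Real.exp (-1 * ξ ω)) ∂P₀ = 0 := by
    rw [integral_sub (integrable_const _) hint, ← mgf, heq]
    simp
  rw [integral_eq_zero_iff_of_nonneg_ae (hle.mono fun ω hω => sub_nonneg.mpr hω)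
    ((integrable_const _).sub hint)] at hzero
  filter_upwards [hzero] with ω hω
  have : Real.exp (-1 * ξ ω) = 1 := by
    simp only [Pi.zero_apply] at hω
    linarith
  rw [Real.exp_eq_one_iff] at this
  linarith

/-- Chernoff's bound with parameter `-1` gives geometric decay in `n`. -/
theorem summable_measureReal_randomWalk_le [IsProbabilityMeasure P₀] [IsProbabilityMeasure P]
    (hm : AEMeasurable ξ P₀) (hξ : ∀ᵐ ω ∂P₀, 0 ≤ ξ ω)
    (hdeg : ¬ ∃ c : ℝ, ∀ᵐ ω ∂P₀, ξ ω = c) (h : IsIndepCopies ξ P₀ ξs P) (t : ℝ) :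
    Summable fun n => P.real {ω | randomWalk ξs n ω ≤ t} := by
  have hlt := mgf_neg_one_lt_one hm hξ hdeg
  have hgeom : Summable fun n : ℕ => Real.exp t * mgf ξ P₀ (-1) ^ (n + 1) :=
    ((summable_geometric_of_lt_one mgf_nonneg hlt).comp_injective
      (add_left_injective 1)).mul_left _
  refine hgeom.of_nonneg_of_le (fun n => measureReal_nonneg) fun n => ?_
  have hmn := h.aemeasurable_randomWalk n
  have hint : Integrable (fun ω => Real.exp (-1 * randomWalk ξs n ω)) P := by
    refine Integrable.of_bound (C := 1) (by fun_prop) ?_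
    filter_upwards [h.ae_randomWalk_nonneg hξ n] with ω hω
    rw [Real.norm_eq_abs, Real.abs_exp, Real.exp_le_one_iff]
    linarith
  have := measure_le_le_exp_mul_mgf (X := randomWalk ξs n) t (by norm_num : (-1 : ℝ) ≤ 0) hint
  rwa [neg_neg, one_mul, h.mgf_randomWalk] at this

theorem antitone_measureReal_randomWalk_le [IsProbabilityMeasure P] (hξ : ∀ᵐ ω ∂P₀, 0 ≤ ξ ω)
    (h : IsIndepCopies ξ P₀ ξs P) (t : ℝ) :
    Antitone fun n => P.real {ω | randomWalk ξs n ω ≤ t} := by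
  refine antitone_nat_of_succ_le fun n => ?_
  refine ENNReal.toReal_mono (measure_ne_top _ _) (measure_mono_ae ?_)
  filter_upwards [h.ae_nonneg hξ (n + 1)] with ω hω hle
  have hle' : randomWalk ξs (n + 1) ω ≤ t := hle
  rw [randomWalk_succ] at hle'
  exact (by linarith : randomWalk ξs n ω ≤ t)

theorem tendsto_measureReal_le_atTop [IsProbabilityMeasure P] {Y : Ω → ℝ}
    (hY : AEMeasurable Y P) : Tendsto (fun t => P.real {ω | Y ω ≤ t}) atTop (𝓝 1) := by
  have := Measure.isProbabilityMeasure_map hY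
  refine (tendsto_cdf_atTop (P.map Y)).congr fun t => ?_
  rw [cdf_eq_real, map_measureReal_apply_of_aemeasurable hY measurableSet_Iic]
  rfl

/-- Crossing level `t` in one step requires either a step longer than `x` or a position within `x`
of `t` just before. The first is unlikely once `x` is large; the second is unlikely for `n ≥ n₀`,
uniformly in `t`, by concentration. For the finitely many `n < n₀`, a large `t` makes `P(S_{n+2} ≤
t)`, the subtracted term, exceed `1 - ε`. -/
theorem eventually_forall_measureReal_randomWalk_le_sub_le [IsProbabilityMeasure P₀]
    [IsProbabilityMeasure P] (hm : AEMeasurable ξ P₀)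
    (hdeg : ¬ ∃ c : ℝ, ∀ᵐ ω ∂P₀, ξ ω = c) (h : IsIndepCopies ξ P₀ ξs P)
    {ε : ℝ} (hε : 0 < ε) :
    ∀ᶠ t : ℝ in atTop, ∀ n, P.real {ω | randomWalk ξs n ω ≤ t}
      - P.real {ω | randomWalk ξs (n + 1) ω ≤ t} ≤ ε := by
  have inst := Measure.isProbabilityMeasure_map hm
  have hdeg' : ¬ ∃ c : ℝ, ∀ᵐ x ∂(P₀.map ξ), x = c := by
    rintro ⟨c, hc⟩
    exact hdeg ⟨c, ae_of_ae_map hm hc⟩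
  obtain ⟨x, hx0, hx⟩ : ∃ x : ℝ, 0 < x ∧ 1 - ε / 2 < P₀.real {ω | ξ ω ≤ x} :=
    ((eventually_gt_atTop 0).and
      ((tendsto_measureReal_le_atTop hm).eventually_const_lt (by linarith))).exists
  have htail : ∀ n, P.real {ω | x < ξs n ω} ≤ ε / 2 := by
    intro n
    have e1 : P.real {ω | x < ξs n ω} = P₀.real {ω | x < ξ ω} := by
      have := (h.law n).measure_mem_eq (measurableSet_Ioi (a := x))
      exact congrArg ENNReal.toReal this
    have e2 : P₀.real {ω | x < ξ ω} = 1 - P₀.real {ω | ξ ω ≤ x} := by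
      have hnull : NullMeasurableSet {ω | ξ ω ≤ x} P₀ :=
        hm.nullMeasurableSet_preimage measurableSet_Iic
      rw [← probReal_compl_eq_one_sub₀ hnull]
      congr 1
      ext ω
      simp
    linarith
  have hdecay := (tendsto_integral_norm_charFun_pow hdeg' hx0).const_mul (Real.exp (1 / 2))
  rw [mul_zero] at hdecay
  obtain ⟨n₀, hn₀⟩ := eventually_atTop.mp (hdecay.eventually_lt_const (half_pos hε))
  have hsmall : ∀ᶠ t : ℝ in atTop, ∀ n ∈ Finset.range n₀,
      1 - ε < P.real {ω | randomWalk ξs (n + 1) ω ≤ t} :=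
    (Finset.range n₀).eventually_all.mpr fun n _ =>
      (tendsto_measureReal_le_atTop (h.aemeasurable_randomWalk (n + 1))).eventually_const_lt
        (by linarith)
  filter_upwards [hsmall] with t ht n
  by_cases hn : n < n₀
  · have := ht n (Finset.mem_range.mpr hn)
    have : P.real {ω | randomWalk ξs n ω ≤ t} ≤ 1 := measureReal_le_one
    linarith
  · have hball : P.real {ω | randomWalk ξs n ω ∈ Metric.closedBall t x} ≤ ε / 2 := by
      have hmn := h.aemeasurable_randomWalk n
      have := Measure.isProbabilityMeasure_map hmn
      have hle := measureReal_closedBall_le_integral_norm_charFun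
        (μ := P.map (randomWalk ξs n)) t hx0
      rw [map_measureReal_apply_of_aemeasurable hmn Metric.isClosed_closedBall.measurableSet] at hle
      simp_rw [h.charFun_map_randomWalk] at hle
      exact hle.trans (hn₀ (n + 1) (by omega)).le
    have hcover : {ω | randomWalk ξs n ω ≤ t} ⊆ {ω | randomWalk ξs (n + 1) ω ≤ t} ∪
        ({ω | x < ξs (n + 1) ω} ∪ {ω | randomWalk ξs n ω ∈ Metric.closedBall t x}) := by
      intro ω hω
      simp only [Set.mem_union, Set.mem_ofPred_eq, Metric.mem_closedBall, Real.dist_eq,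
        randomWalk_succ] at hω ⊢
      by_contra! hcon
      obtain ⟨h1, h2, h3⟩ := hcon
      rw [lt_abs] at h3
      rcases h3 with h3 | h3 <;> linarith
    have h1 := measureReal_mono (μ := P) hcover
    have h2 := h1.trans ((measureReal_union_le _ _).trans
      (add_le_add_right (measureReal_union_le _ _) _))
    linarith [htail (n + 1)]

theorem tendsto_tsum_measureReal_mul_one_sub [IsProbabilityMeasure P₀] [IsProbabilityMeasure P]
    (hm : AEMeasurable ξ P₀) (hξ : ∀ᵐ ω ∂P₀, 0 ≤ ξ ω)
    (hdeg : ¬ ∃ c : ℝ, ∀ᵐ ω ∂P₀, ξ ω = c) (h : IsIndepCopies ξ P₀ ξs P) :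
    Tendsto (fun t : ℝ => ∑' n, P.real {ω | randomWalk ξs n ω ≤ t}
      * (1 - P.real {ω | randomWalk ξs n ω ≤ t})) atTop atTop := by
  rw [tendsto_atTop]
  intro B
  -- With jumps at most `1 / (12 (|B| + 1))`, the lower bound reads `V + 1 ≥ |B| + 1`.
  have hB : 0 < 12 * (|B| + 1) := by positivity
  filter_upwards [eventually_forall_measureReal_randomWalk_le_sub_le hm hdeg h
      (inv_pos.mpr hB),
    (tendsto_measureReal_le_atTop (h.aemeasurable_randomWalk 0)).eventually_const_lt
      (by norm_num : (1 / 2 : ℝ) < 1)] with t ht h0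
  have key := one_div_le_mul_tsum_mul_one_sub
    (q := fun n => P.real {ω | randomWalk ξs n ω ≤ t}) (fun n => measureReal_nonneg)
    (fun n => measureReal_le_one) (antitone_measureReal_randomWalk_le hξ h t)
    (summable_measureReal_randomWalk_le hm hξ hdeg h t) (inv_pos.mpr hB).le ht h0.le
  rw [inv_mul_eq_div, le_div_iff₀ hB] at key
  linarith [le_abs_self B]

end RandomWalk

/-! ### The decoupled count as a sum of independent indicators. -/

namespace IsDecoupled

variable {Ω Ω' : Type*} [MeasurableSpace Ω] [MeasurableSpace Ω'] {P : Measure Ω} {P' : Measure Ω'}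
  {S : ℕ → Ω → ℝ} {Shat : ℕ → Ω' → ℝ}

theorem isBernoulliSeq (h : IsDecoupled S P Shat P') (t : ℝ) :
    IsBernoulliSeq (fun n ω => (Set.Iic t).indicator (fun _ => (1 : ℝ)) (Shat n ω)) P' where
  aemeasurable n := (measurable_const.indicator measurableSet_Iic).comp_aemeasurable
    (h.law n).aemeasurable_fst
  indep := h.indep.comp (fun _ => (Set.Iic t).indicator fun _ => (1 : ℝ))
    fun _ => measurable_const.indicator measurableSet_Iic
  zero_or_one _ _ := Set.indicator_eq_zero_or_self _ _ _

theorem nullMeasurableSet_le (h : IsDecoupled S P Shat P') (t : ℝ) (n : ℕ) :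
    NullMeasurableSet {ω | Shat n ω ≤ t} P' :=
  (h.law n).aemeasurable_fst.nullMeasurableSet_preimage measurableSet_Iic

theorem measure_le_eq (h : IsDecoupled S P Shat P') (t : ℝ) (n : ℕ) :
    P' {ω | Shat n ω ≤ t} = P {ω | S n ω ≤ t} :=
  (h.law n).measure_mem_eq measurableSet_Iic

theorem integral_indicator_eq (h : IsDecoupled S P Shat P') (t : ℝ) (n : ℕ) :
    ∫ ω, (Set.Iic t).indicator (fun _ => (1 : ℝ)) (Shat n ω) ∂P' = P.real {ω | S n ω ≤ t} := by
  have e : (fun ω => (Set.Iic t).indicator (fun _ => (1 : ℝ)) (Shat n ω))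
      = {ω | Shat n ω ≤ t}.indicator fun _ => (1 : ℝ) := rfl
  rw [e, integral_indicator₀ (h.nullMeasurableSet_le t n), setIntegral_const, smul_eq_mul, mul_one,
    measureReal_def, h.measure_le_eq, measureReal_def]

theorem aemeasurable_count (h : IsDecoupled S P Shat P') (t : ℝ) :
    AEMeasurable (countingProcess Shat t) P' :=
  AEMeasurable.tsum fun n => aemeasurable_const.indicator₀ (h.nullMeasurableSet_le t n)

/-- By Tonelli, the expected count is the sum of the probabilities, which is finite. -/
theorem ae_count_lt_top [IsProbabilityMeasure P] (h : IsDecoupled S P Shat P') {t : ℝ}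
    (hs : Summable fun n => P.real {ω | S n ω ≤ t}) :
    ∀ᵐ ω ∂P', countingProcess Shat t ω < ∞ := by
  refine ae_lt_top' (h.aemeasurable_count t) ?_
  have e : ∫⁻ ω, countingProcess Shat t ω ∂P' = ∑' n, P {ω | S n ω ≤ t} := by
    unfold countingProcess
    rw [lintegral_tsum fun n => aemeasurable_const.indicator₀ (h.nullMeasurableSet_le t n)]
    refine tsum_congr fun n => ?_
    rw [lintegral_indicator₀ (h.nullMeasurableSet_le t n), setLIntegral_const, one_mul,
      h.measure_le_eq]
  rw [e, tsum_congr fun n => (ofReal_measureReal (measure_ne_top P _)).symm]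
  exact hs.tsum_ofReal_ne_top

theorem ae_hasSum_realCount [IsProbabilityMeasure P] (h : IsDecoupled S P Shat P') {t : ℝ}
    (hs : Summable fun n => P.real {ω | S n ω ≤ t}) :
    ∀ᵐ ω ∂P', HasSum (fun n => (Set.Iic t).indicator (fun _ => (1 : ℝ)) (Shat n ω))
      (realCount Shat t ω) := by
  filter_upwards [h.ae_count_lt_top hs] with ω hω
  have hsum := ENNReal.hasSum_toReal hω.ne
  have hω' : realCount Shat t ω
      = ∑' n, (Set.indicator {ω' | Shat n ω' ≤ t} (fun _ => (1 : ℝ≥0∞)) ω).toReal :=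
    ENNReal.tsum_toReal_eq fun n => ne_of_lt ((Set.indicator_le_self' (by simp) ω).trans_lt
      ENNReal.one_lt_top)
  rw [hω']
  refine hsum.congr_fun ?_
  intro n
  by_cases hn : Shat n ω ≤ t <;> simp [Set.indicator, hn]

end IsDecoupled

/-! ### Assembly of the theorem. -/

theorem mainTheorem6 {Ω₀ Ω Ω' : Type*}
    [MeasurableSpace Ω₀] [MeasurableSpace Ω] [MeasurableSpace Ω']
    (P₀ : Measure Ω₀) [IsProbabilityMeasure P₀]
    (P : Measure Ω) [IsProbabilityMeasure P]
    (P' : Measure Ω') [IsProbabilityMeasure P']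
    (ξ : Ω₀ → ℝ) (hξ_meas : AEMeasurable ξ P₀) (hξ_nonneg : ∀ᵐ ω ∂P₀, 0 ≤ ξ ω)
    (hξ_nondeg : ¬ ∃ c : ℝ, ∀ᵐ ω ∂P₀, ξ ω = c)
    (ξs : ℕ → Ω → ℝ) (hξs : IsIndepCopies ξ P₀ ξs P)
    (Shat : ℕ → Ω' → ℝ) (hShat : IsDecoupled (randomWalk ξs) P Shat P') :
    -- the counts are almost surely finite and have a finite mean and variance
    (∀ t : ℝ, 0 ≤ t →
      (∀ᵐ ω ∂P', countingProcess Shat t ω < ∞) ∧ MemLp (realCount Shat t) 2 P') ∧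
    Tendsto (fun t : ℝ => variance (realCount Shat t) P') atTop atTop ∧
    Tendsto (fun t : ℝ =>
        P'.real {ω | countingProcess Shat t ω = (⌊∫ ω', realCount Shat t ω' ∂P'⌋₊ : ℝ≥0∞)} /
          (1 / √(2 * Real.pi * variance (realCount Shat t) P')))
      atTop (𝓝 1) := by
  have hs := summable_measureReal_randomWalk_le hξ_meas hξ_nonneg hξ_nondeg hξs
  have hX := hShat.isBernoulliSeq
  have hsX : ∀ t, Summable fun n =>
      ∫ ω, (Set.Iic t).indicator (fun _ => (1 : ℝ)) (Shat n ω) ∂P' := fun t => by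
    simp_rw [hShat.integral_indicator_eq]
    exact hs t
  have hN := fun t => hShat.ae_hasSum_realCount (hs t)
  have hvar : Tendsto (fun t : ℝ => variance (realCount Shat t) P') atTop atTop := by
    refine (tendsto_tsum_measureReal_mul_one_sub hξ_meas hξ_nonneg hξ_nondeg hξs).congr fun t => ?_
    rw [(hX t).variance_sum (hsX t) (hN t)]
    simp_rw [hShat.integral_indicator_eq]
  refine ⟨fun t _ => ⟨hShat.ae_count_lt_top (hs t), (hX t).memLp_sum (hsX t) (hN t)⟩,
    hvar, ?_⟩
  have hlocal := tendsto_sqrt_variance_mul_measureReal (l := atTop)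
    (k := fun t => ⌊∫ ω', realCount Shat t ω' ∂P'⌋₊) (Eventually.of_forall hX)
    (Eventually.of_forall hsX) (Eventually.of_forall hN)
    (fun t => (hShat.aemeasurable_count t).ennreal_toReal) hvar
    (Eventually.of_forall fun t => by
      have h0 : 0 ≤ ∫ ω', realCount Shat t ω' ∂P' :=
        integral_nonneg fun _ => ENNReal.toReal_nonneg
      have h1 := Nat.floor_le h0
      have h2 := Nat.lt_floor_add_one (∫ ω', realCount Shat t ω' ∂P')
      rw [abs_le]
      constructor <;> linarith)
  refine hlocal.congr fun t => ?_
  rw [div_div_eq_mul_div, div_one, mul_comm]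
  congr 1
  refine measureReal_congr ?_
  -- `toReal` sends `∞` to `0`, so the events for the extended and the real count need agree only
  -- where the count is finite, which is almost everywhere.
  filter_upwards [hShat.ae_count_lt_top (hs t)] with ω hω
  refine propext ?_
  change (countingProcess Shat t ω).toReal = _ ↔ countingProcess Shat t ω = _
  rw [← ENNReal.toReal_natCast, ENNReal.toReal_eq_toReal_iff' hω.ne (ENNReal.natCast_ne_top _)]
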